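/- Let $\lambda:[0,\infty)\to[0,\infty)$ be a continuous function, let $\Lambda(t)=\int_0^t\lambda(u)\,du$ for $t\ge 0$, and let $N=(N_t)_{t\ge0}$ be a non-homogeneous Poisson process with intensity function $\lambda$ on a probability space $(\Omega,\mathcal F,\mathbb P)$; that is, $N$ is $\mathbb N$-valued, and almost surely $N_0=0$ and the paths of $N$ are nondecreasing and right-continuous; $N$ has independent increments; and for $0\le s\le t$ the increment $N_t-N_s$ has the Poisson distribution with mean $\Lambda(t)-\Lambda(s)$. Let $\tau^*\ge 0$ and suppose that the limit $\lim_{t\to\infty}\lambda(t)=m\in[0,\infty)$ exists. Then: (i) $\displaystyle\lim_{t\to\infty}\frac{N_t-N_{\tau^*}}{t-\tau^*}=m$ $\mathbb P$-almost surely. (ii) If moreover $\displaystyle\lim_{t\to\infty}\sqrt t\left(\frac{\Lambda(t)}{t}-m\right)=0$, then $\displaystyle\sqrt{t-\tau^*}\left(\frac{N_t-N_{\tau^*}}{t-\tau^*}-m\right)$ converges in distribution, as $t\to\infty$, to the normal distribution $\mathrm N(0,m)$ with mean $0$ and variance $m$ (the point mass at $0$ if $m=0$). -/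

import Mathlib

open MeasureTheory ProbabilityTheory Filter Topology
open scoped NNReal

noncomputable section

/-- The cumulative intensity function `Λ(t) = ∫₀ᵗ lam(u) du` of an intensity `lam : ℝ₊ → ℝ₊`.
The integrand is written on the real line; only its values on `[0, t]` matter. -/
def cumulativeIntensity (lam : ℝ≥0 → ℝ≥0) (t : ℝ≥0) : ℝ≥0 :=
  ⟨∫ u in (0 : ℝ)..(t : ℝ), (lam u.toNNReal : ℝ),
    intervalIntegral.integral_nonneg t.coe_nonneg fun _ _ ↦ NNReal.coe_nonneg _⟩

/-- `N` is a non-homogeneous Poisson process (NHPP) on `(Ω, P)` with cumulative intensity `Λ`: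
a counting process (started at `0`, with nondecreasing right-continuous `ℕ`-valued paths) with
independent increments such that `N t - N s` has the Poisson distribution with mean `Λ t - Λ s`
for `s ≤ t`. The properties of the paths are required almost surely. -/
structure IsNHPP {Ω : Type*} [MeasurableSpace Ω] (N : ℝ≥0 → Ω → ℕ) (Λ : ℝ≥0 → ℝ≥0)
    (P : Measure Ω) : Prop where
  measurable : ∀ t, Measurable (N t)
  zero : ∀ᵐ ω ∂P, N 0 ω = 0
  monotone : ∀ᵐ ω ∂P, Monotone fun t ↦ N t ω
  right_continuous : ∀ᵐ ω ∂P, ∀ t, ContinuousWithinAt (fun s ↦ N s ω) (Set.Ici t) t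
  indep_increments : HasIndepIncrements (fun t ω ↦ (N t ω : ℝ)) P
  law_increments : ∀ s t, s ≤ t →
    HasLaw (fun ω ↦ (N t ω : ℝ) - (N s ω : ℝ))
      ((poissonMeasure (Λ t - Λ s)).map (Nat.cast : ℕ → ℝ)) P

end

/-! A convergent intensity has the same limit as its running average, so Λ(t)/t → m. For (i),
Chebyshev at times n⁴ with threshold n³ bounds the deviation probability by Λ(n⁴)/n⁶ = O(n⁻²).
Borel–Cantelli gives convergence along n⁴ (`ae_tendsto_div`), and monotone paths fill the gaps
because (n+1)⁴/n⁴ → 1. For (ii), the characteristic function of a Poisson increment is explicit; a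
second-order expansion of its exponent yields the Gaussian one (`tendsto_charFun_of_poisson`), the
rate hypothesis removes the centring error, and Lévy's theorem concludes. -/

lemma continuous_intensity_toNNReal {lam : ℝ≥0 → ℝ≥0} (hlam : Continuous lam) :
    Continuous fun u : ℝ ↦ (lam u.toNNReal : ℝ) :=
  NNReal.continuous_coe.comp (hlam.comp continuous_real_toNNReal)

lemma coe_cumulativeIntensity (lam : ℝ≥0 → ℝ≥0) (t : ℝ≥0) :
    (cumulativeIntensity lam t : ℝ) = ∫ u in (0 : ℝ)..(t : ℝ), (lam u.toNNReal : ℝ) := rfl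

lemma cumulativeIntensity_zero (lam : ℝ≥0 → ℝ≥0) : cumulativeIntensity lam 0 = 0 := by
  apply NNReal.coe_injective
  simp [coe_cumulativeIntensity]

lemma cumulativeIntensity_sub {lam : ℝ≥0 → ℝ≥0} (hlam : Continuous lam) (s t : ℝ≥0) :
    (cumulativeIntensity lam t : ℝ) - cumulativeIntensity lam s =
      ∫ u in (s : ℝ)..(t : ℝ), (lam u.toNNReal : ℝ) := by
  have hc := continuous_intensity_toNNReal hlam
  exact intervalIntegral.integral_interval_sub_left (hc.intervalIntegrable _ _)
    (hc.intervalIntegrable _ _)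

lemma monotone_cumulativeIntensity {lam : ℝ≥0 → ℝ≥0} (hlam : Continuous lam) :
    Monotone (cumulativeIntensity lam) := by
  intro s t hst
  rw [← NNReal.coe_le_coe, ← sub_nonneg, cumulativeIntensity_sub hlam]
  exact intervalIntegral.integral_nonneg (by exact_mod_cast hst) fun _ _ ↦ NNReal.coe_nonneg _

/-- If the intensity converges to `m`, so does its running average. -/
lemma tendsto_cumulativeIntensity_div {lam : ℝ≥0 → ℝ≥0} (hlam : Continuous lam) {m : ℝ≥0}
    (hm : Tendsto lam atTop (𝓝 m)) :
    Tendsto (fun t : ℝ≥0 ↦ (cumulativeIntensity lam t : ℝ) / (t : ℝ)) atTop (𝓝 (m : ℝ)) := by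
  rw [Metric.tendsto_atTop]
  intro ε hε
  obtain ⟨T, hT⟩ := Metric.tendsto_atTop.1 hm (ε / 2) (by positivity)
  set A : ℝ := |(cumulativeIntensity lam T : ℝ) - m * T| with hA
  -- `A` is the error accumulated up to `T`; beyond `2 * A / ε` it costs less than `ε / 2` after
  -- division by `t`.
  refine ⟨max (T + 1) (Real.toNNReal (2 * A / ε + 1)), fun t ht ↦ ?_⟩
  have hTt : T + 1 ≤ t := (le_max_left _ _).trans ht
  have hTt' : (T : ℝ) + 1 ≤ t := by exact_mod_cast hTt
  have hT0 : (0 : ℝ) ≤ T := T.coe_nonneg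
  have ht0 : (0 : ℝ) < t := by linarith
  have hAt : 2 * A / ε + 1 ≤ t := Real.toNNReal_le_iff_le_coe.1 ((le_max_right _ _).trans ht)
  have hc := continuous_intensity_toNNReal hlam
  have hbound : |(cumulativeIntensity lam t : ℝ) - cumulativeIntensity lam T - m * (t - T)| ≤
      ε / 2 * (t - T) := by
    have h1 : (cumulativeIntensity lam t : ℝ) - cumulativeIntensity lam T - m * (t - T) =
        ∫ u in (T : ℝ)..(t : ℝ), ((lam u.toNNReal : ℝ) - m) := by
      rw [intervalIntegral.integral_sub (hc.intervalIntegrable _ _) (by simp),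
        cumulativeIntensity_sub hlam, intervalIntegral.integral_const, smul_eq_mul]
      ring
    rw [h1, ← Real.norm_eq_abs]
    refine (intervalIntegral.norm_integral_le_of_norm_le_const (C := ε / 2) fun u hu ↦ ?_).trans ?_
    · rw [Set.uIoc_of_le (by linarith)] at hu
      have := hT u.toNNReal (NNReal.le_toNNReal_of_coe_le hu.1.le)
      rw [NNReal.dist_eq] at this
      exact this.le
    · rw [abs_of_nonneg (by linarith)]
  have htri : |(cumulativeIntensity lam t : ℝ) - m * t| ≤ A + ε / 2 * (t - T) := by
    have : (cumulativeIntensity lam t : ℝ) - m * t = ((cumulativeIntensity lam T : ℝ) - m * T) +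
      ((cumulativeIntensity lam t : ℝ) - cumulativeIntensity lam T - m * (t - T)) := by ring
    rw [this]
    exact (abs_add_le _ _).trans (by gcongr)
  have hA2 : A < ε / 2 * t := by
    have : 2 * A / ε < t := by linarith
    rw [div_lt_iff₀ hε] at this
    linarith
  rw [Real.dist_eq, show (cumulativeIntensity lam t : ℝ) / t - m =
    ((cumulativeIntensity lam t : ℝ) - m * t) / t by field_simp, abs_div, abs_of_pos ht0,
    div_lt_iff₀ ht0]
  nlinarith

/-! ### Mean and variance of the Poisson distribution -/

lemma hasSum_poisson_mul_id (r : ℝ≥0) :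
    HasSum (fun n : ℕ ↦ Real.exp (-r) * r ^ n / (n.factorial) * (n : ℝ)) r := by
  rw [← hasSum_nat_add_iff' 1]
  have h := (hasSum_one_poissonMeasure r).mul_left (r : ℝ)
  simp only [Finset.range_one, Finset.sum_singleton, Nat.cast_zero, mul_zero, sub_zero]
  rw [mul_one] at h
  refine h.congr_fun fun n ↦ ?_
  rw [Nat.factorial_succ]
  push_cast
  field_simp
  ring

/-- Cancelling one factor `n` against `n!` and shifting the index reduces the second moment to `r *
E[X + 1]`. -/
lemma hasSum_poisson_mul_sq (r : ℝ≥0) :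
    HasSum (fun n : ℕ ↦ Real.exp (-r) * r ^ n / (n.factorial) * (n : ℝ) ^ 2) (r ^ 2 + r) := by
  rw [← hasSum_nat_add_iff' 1]
  have h := ((hasSum_poisson_mul_id r).add (hasSum_one_poissonMeasure r)).mul_left (r : ℝ)
  simp only [Finset.range_one, Finset.sum_singleton, Nat.cast_zero, sub_zero, ne_eq,
    OfNat.ofNat_ne_zero, not_false_eq_true, zero_pow, mul_zero]
  rw [show (r : ℝ) * (r + 1) = r ^ 2 + r by ring] at h
  refine h.congr_fun fun n ↦ ?_
  rw [Nat.factorial_succ]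
  push_cast
  field_simp
  ring

lemma memLp_two_map_cast_poissonMeasure (r : ℝ≥0) :
    MemLp id 2 ((poissonMeasure r).map (Nat.cast : ℕ → ℝ)) := by
  rw [memLp_two_iff_integrable_sq measurable_id.aestronglyMeasurable,
    integrable_map_measure (by fun_prop) .of_discrete, integrable_poissonMeasure_iff]
  simpa using (hasSum_poisson_mul_sq r).summable

lemma integral_id_map_cast_poissonMeasure (r : ℝ≥0) :
    ∫ x, x ∂((poissonMeasure r).map (Nat.cast : ℕ → ℝ)) = r := by
  rw [integral_map .of_discrete (by fun_prop), integral_poissonMeasure]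
  exact (hasSum_poisson_mul_id r).tsum_eq

lemma variance_id_map_cast_poissonMeasure (r : ℝ≥0) :
    Var[id; (poissonMeasure r).map (Nat.cast : ℕ → ℝ)] = r := by
  have h2 : ∫ x, x ^ 2 ∂((poissonMeasure r).map (Nat.cast : ℕ → ℝ)) = (r : ℝ) ^ 2 + r := by
    rw [integral_map .of_discrete (by fun_prop), integral_poissonMeasure]
    exact (hasSum_poisson_mul_sq r).tsum_eq
  rw [variance_eq_sub (memLp_two_map_cast_poissonMeasure r)]
  simp [integral_id_map_cast_poissonMeasure, h2]

/-- Chebyshev's inequality for a Poisson random variable. -/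
lemma ProbabilityTheory.HasLaw.measure_le_abs_sub_le_of_poisson {Ω : Type*} [MeasurableSpace Ω] {P : Measure Ω}
    {X : Ω → ℝ} {r : ℝ≥0}
    (hX : HasLaw X ((poissonMeasure r).map (Nat.cast : ℕ → ℝ)) P) {c : ℝ} (hc : 0 < c) :
    P {ω | c ≤ |X ω - r|} ≤ ENNReal.ofReal (r / c ^ 2) := by
  have h := meas_ge_le_variance_div_sq (memLp_two_map_cast_poissonMeasure r) hc
  rw [variance_id_map_cast_poissonMeasure] at h
  simp only [id_eq, integral_id_map_cast_poissonMeasure] at h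
  rw [← hX.map_eq, Measure.map_apply_of_aemeasurable hX.aemeasurable
    (measurableSet_le (by fun_prop) (by fun_prop))] at h
  exact h

/-- For a nonnegative monotone function, convergence of `f t / t` can be checked along the
fourth powers. -/
lemma tendsto_div_of_tendsto_div_pow_four {f : ℝ≥0 → ℝ} (hf : Monotone f) (hf0 : ∀ t, 0 ≤ f t)
    {m : ℝ} (h : Tendsto (fun n : ℕ ↦ f ((n : ℝ≥0) ^ 4) / (n : ℝ) ^ 4) atTop (𝓝 m)) :
    Tendsto (fun t : ℝ≥0 ↦ f t / (t : ℝ)) atTop (𝓝 m) := by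
  -- The integer part of the fourth root, so that `k t ^ 4 ≤ t ≤ (k t + 1) ^ 4`.
  set k : ℝ≥0 → ℕ := fun t ↦ ⌊NNReal.sqrt (NNReal.sqrt t)⌋₊ with hk
  have hsqrt : Tendsto NNReal.sqrt atTop atTop := NNReal.sqrt.tendsto_atTop
  have hktop : Tendsto k atTop atTop := tendsto_nat_floor_atTop.comp (hsqrt.comp hsqrt)
  have hpow (t : ℝ≥0) : NNReal.sqrt (NNReal.sqrt t) ^ 4 = t := by
    rw [show 4 = 2 * 2 by norm_num, pow_mul, NNReal.sq_sqrt, NNReal.sq_sqrt]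
  have hlow (t : ℝ≥0) : (k t : ℝ≥0) ^ 4 ≤ t := by
    calc (k t : ℝ≥0) ^ 4 ≤ NNReal.sqrt (NNReal.sqrt t) ^ 4 := by
          gcongr; exact Nat.floor_le (zero_le)
      _ = t := hpow t
  have hup (t : ℝ≥0) : t ≤ ((k t + 1 : ℕ) : ℝ≥0) ^ 4 := by
    calc t = NNReal.sqrt (NNReal.sqrt t) ^ 4 := (hpow t).symm
      _ ≤ _ := by
          gcongr; push_cast; exact (Nat.lt_floor_add_one _).le
  have hratio : Tendsto (fun n : ℕ ↦ ((n : ℝ) / ((n : ℝ) + 1)) ^ 4) atTop (𝓝 1) := by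
    simpa using (tendsto_natCast_div_add_atTop (1 : ℝ)).pow 4
  have hL : Tendsto (fun n : ℕ ↦ f ((n : ℝ≥0) ^ 4) / (n : ℝ) ^ 4 *
      ((n : ℝ) / ((n : ℝ) + 1)) ^ 4) atTop (𝓝 m) := by
    simpa using h.mul hratio
  have hU : Tendsto (fun n : ℕ ↦ f (((n + 1 : ℕ) : ℝ≥0) ^ 4) / ((n + 1 : ℕ) : ℝ) ^ 4 /
      ((n : ℝ) / ((n : ℝ) + 1)) ^ 4) atTop (𝓝 m) := by
    simpa [Function.comp_def, Pi.div_def] using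
      (h.comp (tendsto_add_atTop_nat 1)).div hratio one_ne_zero
  refine tendsto_of_tendsto_of_tendsto_of_le_of_le' (hL.comp hktop) (hU.comp hktop) ?_ ?_
  · filter_upwards [hktop.eventually_gt_atTop 0, eventually_gt_atTop 0] with t hkt ht
    have hk0 : (0 : ℝ) < k t := by exact_mod_cast hkt
    have ht0 : (0 : ℝ) < t := by exact_mod_cast ht
    have hup' : (t : ℝ) ≤ ((k t : ℝ) + 1) ^ 4 := by exact_mod_cast hup t
    calc f ((k t : ℝ≥0) ^ 4) / (k t : ℝ) ^ 4 * ((k t : ℝ) / ((k t : ℝ) + 1)) ^ 4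
        = f ((k t : ℝ≥0) ^ 4) / ((k t : ℝ) + 1) ^ 4 := by field_simp
      _ ≤ f ((k t : ℝ≥0) ^ 4) / t := div_le_div_of_nonneg_left (hf0 _) ht0 hup'
      _ ≤ f t / t := by gcongr; exact hf (hlow t)
  · filter_upwards [hktop.eventually_gt_atTop 0, eventually_gt_atTop 0] with t hkt ht
    have hk0 : (0 : ℝ) < k t := by exact_mod_cast hkt
    have ht0 : (0 : ℝ) < t := by exact_mod_cast ht
    have hlow' : (k t : ℝ) ^ 4 ≤ t := by exact_mod_cast hlow t
    calc f t / t ≤ f (((k t + 1 : ℕ) : ℝ≥0) ^ 4) / t := by gcongr; exact hf (hup t)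
      _ ≤ f (((k t + 1 : ℕ) : ℝ≥0) ^ 4) / (k t : ℝ) ^ 4 :=
          div_le_div_of_nonneg_left (hf0 _) (by positivity) hlow'
      _ = _ := by simp only [Function.comp_apply]; push_cast; field_simp

/-! ### Moving the origin of time to τ -/

lemma tendsto_coe_sub_const_atTop (τ : ℝ≥0) :
    Tendsto (fun t : ℝ≥0 ↦ (t : ℝ) - τ) atTop atTop :=
  tendsto_atTop_add_const_right _ _ (NNReal.tendsto_coe_atTop.2 tendsto_id)

lemma tendsto_div_coe_sub_const (τ : ℝ≥0) :
    Tendsto (fun t : ℝ≥0 ↦ (t : ℝ) / ((t : ℝ) - τ)) atTop (𝓝 1) := by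
  have h := ((tendsto_coe_sub_const_atTop τ).const_div_atTop (τ : ℝ)).const_add 1
  rw [add_zero] at h
  refine h.congr' ?_
  filter_upwards [eventually_gt_atTop τ] with t ht
  have : (0 : ℝ) < t - τ := sub_pos.2 (by exact_mod_cast ht)
  field_simp
  ring

lemma tendsto_sub_div_sub_of_tendsto_div {f : ℝ≥0 → ℝ} {m : ℝ}
    (h : Tendsto (fun t : ℝ≥0 ↦ f t / (t : ℝ)) atTop (𝓝 m)) (τ : ℝ≥0) :
    Tendsto (fun t : ℝ≥0 ↦ (f t - f τ) / ((t : ℝ) - τ)) atTop (𝓝 m) := by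
  have h' := (h.mul (tendsto_div_coe_sub_const τ)).sub
    ((tendsto_coe_sub_const_atTop τ).const_div_atTop (f τ))
  rw [mul_one, sub_zero] at h'
  refine h'.congr' ?_
  filter_upwards [eventually_gt_atTop τ] with t ht
  have : (0 : ℝ) < t - τ := sub_pos.2 (by exact_mod_cast ht)
  have : (0 : ℝ) < t := by exact_mod_cast (zero_le (a := τ)).trans_lt ht
  field_simp

/-! ### Strong law of large numbers -/

namespace IsNHPP

variable {Ω : Type*} [MeasurableSpace Ω] {P : Measure Ω} {N : ℝ≥0 → Ω → ℕ} {Λ : ℝ≥0 → ℝ≥0}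

lemma hasLaw_poisson (hN : IsNHPP N Λ P) (h0 : Λ 0 = 0) (t : ℝ≥0) :
    HasLaw (fun ω ↦ (N t ω : ℝ)) ((poissonMeasure (Λ t)).map (Nat.cast : ℕ → ℝ)) P := by
  have h := hN.law_increments 0 t (zero_le)
  rw [h0, tsub_zero] at h
  refine h.congr ?_
  filter_upwards [hN.zero] with ω hω
  simp [hω]

/-- The strong law of large numbers for a non-homogeneous Poisson process. -/
lemma ae_tendsto_div (hN : IsNHPP N Λ P) (h0 : Λ 0 = 0) {m : ℝ}
    (hΛ : Tendsto (fun t : ℝ≥0 ↦ (Λ t : ℝ) / (t : ℝ)) atTop (𝓝 m)) :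
    ∀ᵐ ω ∂P, Tendsto (fun t : ℝ≥0 ↦ (N t ω : ℝ) / (t : ℝ)) atTop (𝓝 m) := by
  have hpow : Tendsto (fun n : ℕ ↦ (n : ℝ≥0) ^ 4) atTop atTop :=
    (tendsto_pow_atTop four_ne_zero).comp tendsto_natCast_atTop_atTop
  have hΛ4 : Tendsto (fun n : ℕ ↦ (Λ ((n : ℝ≥0) ^ 4) : ℝ) / (n : ℝ) ^ 4) atTop (𝓝 m) := by
    simpa [Function.comp_def] using hΛ.comp hpow
  have hsum : Summable fun n : ℕ ↦ (Λ ((n : ℝ≥0) ^ 4) : ℝ) / ((n : ℝ) ^ 3) ^ 2 := by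
    refine summable_of_isBigO_nat (Real.summable_one_div_nat_pow.2 one_lt_two) ?_
    have h := (hΛ4.isBigO_one ℝ).mul
      (Asymptotics.isBigO_refl (fun n : ℕ ↦ 1 / (n : ℝ) ^ 2) atTop)
    simp only [one_mul] at h
    refine h.congr_left fun n ↦ ?_
    rw [div_mul_div_comm, mul_one]
    congr 1
    ring
  -- The threshold n³ is o(n⁴), so a single Borel–Cantelli argument suffices, with no quantifier
  -- over ε. The guard `0 < n` empties the event at `n = 0`, where the threshold vanishes and
  -- Chebyshev does not apply.
  have hBC : ∀ᵐ ω ∂P, ∀ᶠ n : ℕ in atTop,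
      ω ∉ {ω | 0 < n ∧ (n : ℝ) ^ 3 ≤ |(N ((n : ℝ≥0) ^ 4) ω : ℝ) - Λ ((n : ℝ≥0) ^ 4)|} := by
    refine ae_eventually_notMem (ne_top_of_le_ne_top hsum.tsum_ofReal_ne_top
      (ENNReal.tsum_le_tsum fun n ↦ ?_))
    rcases n.eq_zero_or_pos with rfl | hn
    · simp
    · exact (measure_mono fun ω hω ↦ hω.2).trans
        ((hN.hasLaw_poisson h0 _).measure_le_abs_sub_le_of_poisson (by positivity))
  filter_upwards [hBC, hN.monotone] with ω hω hmono
  refine tendsto_div_of_tendsto_div_pow_four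
    (fun s t hst ↦ by exact_mod_cast hmono hst) (fun t ↦ by positivity) ?_
  have hdiff : Tendsto (fun n : ℕ ↦ (N ((n : ℝ≥0) ^ 4) ω : ℝ) / (n : ℝ) ^ 4 -
      (Λ ((n : ℝ≥0) ^ 4) : ℝ) / (n : ℝ) ^ 4) atTop (𝓝 0) := by
    refine squeeze_zero_norm' ?_ tendsto_one_div_atTop_nhds_zero_nat
    filter_upwards [hω, eventually_gt_atTop 0] with n hn hn0
    simp only [not_and, not_le] at hn
    have hnpos : (0 : ℝ) < n := by exact_mod_cast hn0
    rw [← sub_div, norm_div, Real.norm_eq_abs, norm_pow, Real.norm_natCast,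
      div_le_div_iff₀ (by positivity) hnpos]
    calc _ ≤ (n : ℝ) ^ 3 * n := by gcongr; exact (hn hn0).le
      _ = _ := by ring
  simpa using hdiff.add hΛ4

end IsNHPP

/-! ### Central limit theorem by characteristic functions -/

lemma tendsto_exp_mul_I_sub_div_sq (s : ℝ) :
    Tendsto (fun h : ℝ ↦ (Complex.exp ((h * s : ℝ) * Complex.I) - 1 - (h * s : ℝ) * Complex.I) /
      (h : ℂ) ^ 2) (𝓝[≠] 0) (𝓝 (-(s : ℂ) ^ 2 / 2)) := by
  rw [tendsto_iff_norm_sub_tendsto_zero]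
  -- The cubic Taylor remainder bound `‖z‖ ^ 3 * exp ‖z‖` at `z = ihs`, divided by `h ^ 2`.
  have hlim : Tendsto (fun h : ℝ ↦ |h| * |s| ^ 3 * Real.exp |h * s|) (𝓝[≠] 0) (𝓝 0) := by
    have hc : Continuous fun h : ℝ ↦ |h| * |s| ^ 3 * Real.exp |h * s| := by fun_prop
    exact (hc.tendsto' 0 0 (by simp)).mono_left nhdsWithin_le_nhds
  refine squeeze_zero' (.of_forall fun _ ↦ norm_nonneg _) ?_ hlim
  filter_upwards [self_mem_nhdsWithin] with h hh
  have hh' : (h : ℂ) ≠ 0 := by exact_mod_cast hh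
  have hpos : 0 < |h| := abs_pos.2 hh
  have key := Complex.norm_exp_sub_sum_le_norm_mul_exp ((h * s : ℝ) * Complex.I) 3
  have hnorm : ‖((h * s : ℝ) : ℂ) * Complex.I‖ = |h * s| := by simp
  rw [hnorm] at key
  have heq : (Complex.exp ((h * s : ℝ) * Complex.I) - 1 - (h * s : ℝ) * Complex.I) / (h : ℂ) ^ 2 -
      -(s : ℂ) ^ 2 / 2 = (Complex.exp ((h * s : ℝ) * Complex.I) -
        ∑ j ∈ Finset.range 3, ((h * s : ℝ) * Complex.I) ^ j / (j.factorial : ℂ)) / (h : ℂ) ^ 2 := by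
    simp only [Finset.sum_range_succ, Finset.sum_range_zero, Nat.factorial, mul_pow, Complex.I_sq]
    field_simp
    push_cast
    ring
  rw [heq, norm_div, norm_pow, Complex.norm_real, Real.norm_eq_abs, div_le_iff₀ (by positivity)]
  refine key.trans (le_of_eq ?_)
  rw [abs_mul]
  ring

lemma ProbabilityTheory.HasLaw.charFun_mul_add_of_poisson {Ω : Type*} [MeasurableSpace Ω] {P : Measure Ω} {X : Ω → ℝ}
    {r : ℝ≥0} (hX : HasLaw X ((poissonMeasure r).map (Nat.cast : ℕ → ℝ)) P) (a b s : ℝ) :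
    charFun (P.map fun ω ↦ a * X ω + b) s =
      Complex.exp (r * (Complex.exp ((a * s : ℝ) * Complex.I) - 1) + (b * s : ℝ) * Complex.I) := by
  have h : P.map (fun ω ↦ a * X ω + b) = (P.map (fun ω ↦ a * X ω)).map (· + b) := by
    rw [AEMeasurable.map_map_of_aemeasurable (by fun_prop) (hX.aemeasurable.const_mul a)]
    rfl
  rw [h, charFun_map_add_const, charFun_map_mul_comp hX.aemeasurable, hX.map_eq,
    charFun_map_cast_poissonMeasure, ← Complex.exp_add]
  simp [mul_comm]

/-- The central limit theorem for Poisson random variables `X t` with means `r t`, normalised by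
a deterministic scale `c t → ∞` with `r t / c t → m` and `(r t - m * c t) / √(c t) → 0`. -/
lemma tendsto_charFun_of_poisson {Ω ι : Type*} [MeasurableSpace Ω] {P : Measure Ω} {l : Filter ι}
    {X : ι → Ω → ℝ} {r : ι → ℝ≥0} {c : ι → ℝ} {m : ℝ≥0}
    (hX : ∀ᶠ t in l, HasLaw (X t) ((poissonMeasure (r t)).map (Nat.cast : ℕ → ℝ)) P)
    (hc : Tendsto c l atTop) (hr : Tendsto (fun t ↦ (r t : ℝ) / c t) l (𝓝 m))
    (hd : Tendsto (fun t ↦ ((r t : ℝ) - m * c t) / √(c t)) l (𝓝 0)) (s : ℝ) :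
    Tendsto (fun t ↦ charFun (P.map fun ω ↦ √(c t) * (X t ω / c t - m)) s) l
      (𝓝 (charFun (gaussianReal 0 m) s)) := by
  have hh0 : Tendsto (fun t ↦ (√(c t))⁻¹) l (𝓝[≠] 0) := by
    refine tendsto_nhdsWithin_iff.2
      ⟨tendsto_inv_atTop_zero.comp (Real.tendsto_sqrt_atTop.comp hc), ?_⟩
    filter_upwards [hc.eventually_gt_atTop 0] with t ht
    exact inv_ne_zero (Real.sqrt_pos.2 ht).ne'
  have hr' : Tendsto (fun t ↦ (((r t : ℝ) / c t : ℝ) : ℂ)) l (𝓝 ((m : ℝ) : ℂ)) :=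
    (Complex.continuous_ofReal.tendsto _).comp hr
  have hd' : Tendsto (fun t ↦ ((((r t : ℝ) - m * c t) / √(c t) : ℝ) : ℂ)) l (𝓝 ((0 : ℝ) : ℂ)) :=
    (Complex.continuous_ofReal.tendsto _).comp hd
  -- With h = 1/√c, the exponent r(e^{ihs} − 1) − i√c·m·s splits as (r/c)·(e^{ihs} − 1 − ihs)/h² +
  -- ((r − mc)/√c)·is.
  have hmain := (hr'.mul ((tendsto_exp_mul_I_sub_div_sq s).comp hh0)).add
    (hd'.mul_const ((s : ℂ) * Complex.I))
  rw [charFun_gaussianReal]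
  have hlim : ((m : ℝ) : ℂ) * (-(s : ℂ) ^ 2 / 2) + ((0 : ℝ) : ℂ) * ((s : ℂ) * Complex.I) =
      (s : ℂ) * ((0 : ℝ) : ℂ) * Complex.I - ((m : ℝ) : ℂ) * (s : ℂ) ^ 2 / 2 := by
    push_cast
    ring
  rw [hlim] at hmain
  refine ((Complex.continuous_exp.tendsto _).comp hmain).congr' ?_
  filter_upwards [hX, hc.eventually_gt_atTop 0] with t hXt ht
  have hq : 0 < √(c t) := Real.sqrt_pos.2 ht
  have hfun : (fun ω ↦ √(c t) * (X t ω / c t - m)) =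
      fun ω ↦ (√(c t))⁻¹ * X t ω + -(√(c t) * m) := by
    ext ω
    have : c t = √(c t) * √(c t) := (Real.mul_self_sqrt ht.le).symm
    rw [mul_sub, sub_eq_add_neg]
    congr 1
    conv_lhs => rw [this]
    field_simp
    rw [Real.sqrt_sq hq.le]
  rw [hfun, hXt.charFun_mul_add_of_poisson]
  simp only [Function.comp_apply]
  congr 1
  set q := √(c t) with hqdef
  have hcq : c t = q ^ 2 := (Real.sq_sqrt ht.le).symm
  have hqc : (q : ℂ) ≠ 0 := by exact_mod_cast hq.ne'
  rw [hcq]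
  push_cast
  field_simp
  ring

lemma tendstoInDistribution_of_tendsto_charFun {Ω ι : Type*} [MeasurableSpace Ω] {P : Measure Ω}
    [IsProbabilityMeasure P] {l : Filter ι} [l.IsCountablyGenerated] {X : ι → Ω → ℝ}
    (hX : ∀ t, AEMeasurable (X t) P) {ν : Measure ℝ} [IsProbabilityMeasure ν]
    (h : ∀ s, Tendsto (fun t ↦ charFun (P.map (X t)) s) l (𝓝 (charFun ν s))) :
    TendstoInDistribution X l (id : ℝ → ℝ) (fun _ ↦ P) ν where
  forall_aemeasurable := hX
  tendsto := by
    -- Lévy's theorem is applied along sequences, which detect convergence since `l` is countably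
    -- generated.
    refine tendsto_of_seq_tendsto fun u hu ↦
      ProbabilityMeasure.tendsto_of_tendsto_charFun fun s ↦ ?_
    simp only [ProbabilityMeasure.coe_mk, Measure.map_id]
    exact (h s).comp hu

/-- The centring error is negligible after shifting the origin of time to `τ`. -/
lemma tendsto_sub_mul_div_sqrt {f : ℝ≥0 → ℝ} {m : ℝ} (τ : ℝ≥0)
    (h : Tendsto (fun t : ℝ≥0 ↦ √(t : ℝ) * (f t / (t : ℝ) - m)) atTop (𝓝 0)) :
    Tendsto (fun t : ℝ≥0 ↦ (f t - f τ - m * ((t : ℝ) - τ)) / √((t : ℝ) - τ)) atTop (𝓝 0) := by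
  have hratio : Tendsto (fun t : ℝ≥0 ↦ √((t : ℝ) / ((t : ℝ) - τ))) atTop (𝓝 1) := by
    simpa using (tendsto_div_coe_sub_const τ).sqrt
  have hconst := (Real.tendsto_sqrt_atTop.comp (tendsto_coe_sub_const_atTop τ)).const_div_atTop
    (f τ - m * τ)
  -- The numerator is (f t − m t) − (f τ − m τ): the first part is the hypothesis rescaled by √(t/(t
  -- − τ)), the second is constant.
  have hmain := (h.mul hratio).sub hconst
  rw [zero_mul, sub_zero] at hmain
  refine hmain.congr' ?_
  filter_upwards [eventually_gt_atTop τ] with t ht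
  have h1 : (0 : ℝ) < t - τ := sub_pos.2 (by exact_mod_cast ht)
  have h2 : (0 : ℝ) < t := by exact_mod_cast (zero_le (a := τ)).trans_lt ht
  have h3 := Real.sqrt_pos.2 h1
  have h4 := Real.sq_sqrt h2.le
  simp only [Function.comp_apply]
  rw [Real.sqrt_div h2.le]
  field_simp
  rw [h4]
  ring

theorem theorem4 {Ω : Type*} [MeasurableSpace Ω] (P : Measure Ω) [IsProbabilityMeasure P]
    (lam : ℝ≥0 → ℝ≥0) (hlam : Continuous lam)
    (N : ℝ≥0 → Ω → ℕ) (hN : IsNHPP N (cumulativeIntensity lam) P)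
    (τ m : ℝ≥0) (hm : Tendsto lam atTop (𝓝 m)) :
    (∀ᵐ ω ∂P, Tendsto (fun t : ℝ≥0 ↦ ((N t ω : ℝ) - (N τ ω : ℝ)) / ((t : ℝ) - (τ : ℝ)))
        atTop (𝓝 (m : ℝ))) ∧
    (Tendsto (fun t : ℝ≥0 ↦ √(t : ℝ) * ((cumulativeIntensity lam t : ℝ) / (t : ℝ) - (m : ℝ)))
        atTop (𝓝 0) →
      TendstoInDistribution
        (fun (t : ℝ≥0) (ω : Ω) ↦ √((t : ℝ) - (τ : ℝ)) *
          (((N t ω : ℝ) - (N τ ω : ℝ)) / ((t : ℝ) - (τ : ℝ)) - (m : ℝ)))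
        atTop (id : ℝ → ℝ) (fun _ ↦ P) (gaussianReal 0 m)) := by
  have hΛ := tendsto_cumulativeIntensity_div hlam hm
  refine ⟨?_, fun hrate ↦ ?_⟩
  · filter_upwards [hN.ae_tendsto_div (cumulativeIntensity_zero lam) hΛ] with ω hω
    exact tendsto_sub_div_sub_of_tendsto_div hω τ
  -- Subtraction in `ℝ≥0` truncates; monotonicity makes it the real difference once `τ ≤ t`.
  · have hcoe : ∀ᶠ t in atTop, ((cumulativeIntensity lam t - cumulativeIntensity lam τ : ℝ≥0) : ℝ) =
        (cumulativeIntensity lam t : ℝ) - cumulativeIntensity lam τ := by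
      filter_upwards [eventually_ge_atTop τ] with t ht
      exact NNReal.coe_sub (monotone_cumulativeIntensity hlam ht)
    refine tendstoInDistribution_of_tendsto_charFun (fun t ↦ ?_) fun s ↦
      tendsto_charFun_of_poisson (X := fun t ω ↦ (N t ω : ℝ) - N τ ω)
        (r := fun t ↦ cumulativeIntensity lam t - cumulativeIntensity lam τ)
        ?_ (tendsto_coe_sub_const_atTop τ) ?_ ?_ s
    · have h1 : Measurable fun ω ↦ (N t ω : ℝ) := measurable_from_nat.comp (hN.measurable t)
      have h2 : Measurable fun ω ↦ (N τ ω : ℝ) := measurable_from_nat.comp (hN.measurable τ)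
      fun_prop
    · filter_upwards [eventually_ge_atTop τ] with t ht using hN.law_increments τ t ht
    · refine (tendsto_sub_div_sub_of_tendsto_div hΛ τ).congr' ?_
      filter_upwards [hcoe] with t ht
      rw [ht]
    · refine (tendsto_sub_mul_div_sqrt τ hrate).congr' ?_
      filter_upwards [hcoe] with t ht
      rw [ht]
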